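/- Let $\mathbb{Q}_{\mathbb R}$ be the algebra of reduced biquaternions $p_0+p_1\mathbf i+p_2\mathbf j+p_3\mathbf k$, $p_t\in\mathbb R$, with $\mathbf i^2=\mathbf k^2=-1$, $\mathbf j^2=1$, $\mathbf{ij}=\mathbf{ji}=\mathbf k$, $\mathbf{jk}=\mathbf{kj}=\mathbf i$, $\mathbf{ki}=\mathbf{ik}=-\mathbf j$, and $\|p_0+p_1\mathbf i+p_2\mathbf j+p_3\mathbf k\|=\sqrt{p_0^2+p_1^2+p_2^2+p_3^2}$. For a matrix $M$ over $\mathbb R$, $\mathbb C$ or $\mathbb{Q}_{\mathbb R}$ let $\|M\|_F=\big(\sum_{i,j}\|m_{ij}\|^2\big)^{1/2}$, let $\|\cdot\|_2$ be the operator $2$-norm and $\dagger$ the Moore–Penrose inverse of complex matrices. Write $M\in\mathbb{Q}_{\mathbb R}^{m\times n}$ as $M=N_1+N_2\mathbf j$ with $N_1,N_2\in\mathbb C^{m\times n}$ and put $M^C_c=\begin{bmatrix}N_1\\N_2\end{bmatrix}\in\mathbb C^{2m\times n}$. Let $A\in\mathbb{Q}_{\mathbb R}^{m\times n}$, $B\in\mathbb{Q}_{\mathbb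 R}^{m\times d}$, $C\in\mathbb{Q}_{\mathbb R}^{p\times n}$, $D\in\mathbb{Q}_{\mathbb R}^{p\times d}$ with $m\ge n+d$ and $C^C_c$ of full row rank $2p$. Suppose that the complex reduced biquaternion equality constrained least squares (RBLSE) problem $$\min_{X\in\mathbb C^{n\times d}}\|AX-B\|_F\quad\text{subject to}\quad CX=D$$ has a unique solution $X_{CL}$, and that $X_{CL}\neq0$. Put $$P_c=I_n-(C^C_c)^\dagger C^C_c,\qquad \mathcal L_c=\big(I_n-(A^C_cP_c)^\dagger A^C_c\big)(C^C_c)^\dagger,\qquad R_c=B^C_c-A^C_cX_{CL},$$ $$\mathcal K_A^C=\|C^C_c\|_F\|\mathcal L_c\|_2,\qquad \mathcal K_B^C=\|A^C_c\|_F\|(A^C_cP_c)^\dagger\|_2 .$$ Then there are constants $K\ge0$ and $\epsilon_0>0$, depending only on $A,B,C,D$, such that for every $0\le\epsilon\le\epsilon_0$ and all $\Delta A,\Delta B,\Delta C,\Delta D$ with $$\|\Delta A\|_F\le\epsilon\|A\|_F,\quad\|\Delta B\|_F\le\epsilon\|B\|_F,\quad\|\Delta C\|_F\le\epsilon\|C\|_F,\quad\|\Delta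 D\|_F\le\epsilon\|D\|_F,$$ the matrix $(C+\Delta C)^C_c$ has full row rank, the perturbed problem $$\min_{X\in\mathbb C^{n\times d}}\|(A+\Delta A)X-(B+\Delta B)\|_F\quad\text{subject to}\quad (C+\Delta C)X=D+\Delta D$$ has a unique solution $\widehat X_{CL}$, and $\Delta X_{CL}=\widehat X_{CL}-X_{CL}$ satisfies $$\begin{aligned}\frac{\|\Delta X_{CL}\|_F}{\|X_{CL}\|_F}\le\epsilon\bigg(&\mathcal K_A^C\Big(\frac{\|D^C_c\|_F}{\|C^C_c\|_F\|X_{CL}\|_F}+1\Big)+\mathcal K_B^C\Big(\frac{\|B^C_c\|_F}{\|A^C_c\|_F\|X_{CL}\|_F}+1\Big)\\&+(\mathcal K_B^C)^2\Big(\frac{\|C^C_c\|_F}{\|A^C_c\|_F}\|A^C_c\mathcal L_c\|_2+1\Big)\frac{\|R_c\|_F}{\|A^C_c\|_F\|X_{CL}\|_F}\bigg)+K\epsilon^2 .\end{aligned}$$ (A quotient with zero denominator, which occurs only if $p=0$ or $A=0$, is read as $0$.) -/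

import Mathlib

open scoped Matrix

/-- Reduced biquaternions (commutative quaternions) `re + imI i + imJ j + imK k` over `ℝ`, with
`i² = k² = -1`, `j² = 1`, `ij = ji = k`, `jk = kj = i`, `ki = ik = -j`. -/
@[ext]
structure ReducedBiquaternion where
  re : ℝ
  imI : ℝ
  imJ : ℝ
  imK : ℝ

namespace ReducedBiquaternion

instance : Zero ReducedBiquaternion := ⟨⟨0, 0, 0, 0⟩⟩
instance : One ReducedBiquaternion := ⟨⟨1, 0, 0, 0⟩⟩
instance : Neg ReducedBiquaternion := ⟨fun x => ⟨-x.re, -x.imI, -x.imJ, -x.imK⟩⟩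
instance : Add ReducedBiquaternion :=
  ⟨fun x y => ⟨x.re + y.re, x.imI + y.imI, x.imJ + y.imJ, x.imK + y.imK⟩⟩
instance : Sub ReducedBiquaternion :=
  ⟨fun x y => ⟨x.re - y.re, x.imI - y.imI, x.imJ - y.imJ, x.imK - y.imK⟩⟩
instance : Mul ReducedBiquaternion :=
  ⟨fun x y =>
    ⟨x.re * y.re - x.imI * y.imI + x.imJ * y.imJ - x.imK * y.imK,
     x.re * y.imI + x.imI * y.re + x.imJ * y.imK + x.imK * y.imJ,
     x.re * y.imJ + x.imJ * y.re - x.imI * y.imK - x.imK * y.imI,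
     x.re * y.imK + x.imK * y.re + x.imI * y.imJ + x.imJ * y.imI⟩⟩

@[simp] theorem re_zero : (0 : ReducedBiquaternion).re = 0 := rfl
@[simp] theorem imI_zero : (0 : ReducedBiquaternion).imI = 0 := rfl
@[simp] theorem imJ_zero : (0 : ReducedBiquaternion).imJ = 0 := rfl
@[simp] theorem imK_zero : (0 : ReducedBiquaternion).imK = 0 := rfl
@[simp] theorem re_one : (1 : ReducedBiquaternion).re = 1 := rfl
@[simp] theorem imI_one : (1 : ReducedBiquaternion).imI = 0 := rfl
@[simp] theorem imJ_one : (1 : ReducedBiquaternion).imJ = 0 := rfl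
@[simp] theorem imK_one : (1 : ReducedBiquaternion).imK = 0 := rfl

section
variable (x y : ReducedBiquaternion)
@[simp] theorem re_neg : (-x).re = -x.re := rfl
@[simp] theorem imI_neg : (-x).imI = -x.imI := rfl
@[simp] theorem imJ_neg : (-x).imJ = -x.imJ := rfl
@[simp] theorem imK_neg : (-x).imK = -x.imK := rfl
@[simp] theorem re_add : (x + y).re = x.re + y.re := rfl
@[simp] theorem imI_add : (x + y).imI = x.imI + y.imI := rfl
@[simp] theorem imJ_add : (x + y).imJ = x.imJ + y.imJ := rfl
@[simp] theorem imK_add : (x + y).imK = x.imK + y.imK := rfl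
@[simp] theorem re_sub : (x - y).re = x.re - y.re := rfl
@[simp] theorem imI_sub : (x - y).imI = x.imI - y.imI := rfl
@[simp] theorem imJ_sub : (x - y).imJ = x.imJ - y.imJ := rfl
@[simp] theorem imK_sub : (x - y).imK = x.imK - y.imK := rfl
@[simp] theorem re_mul :
    (x * y).re = x.re * y.re - x.imI * y.imI + x.imJ * y.imJ - x.imK * y.imK := rfl
@[simp] theorem imI_mul :
    (x * y).imI = x.re * y.imI + x.imI * y.re + x.imJ * y.imK + x.imK * y.imJ := rfl
@[simp] theorem imJ_mul :
    (x * y).imJ = x.re * y.imJ + x.imJ * y.re - x.imI * y.imK - x.imK * y.imI := rfl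
@[simp] theorem imK_mul :
    (x * y).imK = x.re * y.imK + x.imK * y.re + x.imI * y.imJ + x.imJ * y.imI := rfl
end

instance : CommRing ReducedBiquaternion where
  add_assoc x y z := by ext <;> simp <;> ring
  zero_add x := by ext <;> simp
  add_zero x := by ext <;> simp
  add_comm x y := by ext <;> simp <;> ring
  neg_add_cancel x := by ext <;> simp
  sub_eq_add_neg x y := by ext <;> simp <;> ring
  left_distrib x y z := by ext <;> simp <;> ring
  right_distrib x y z := by ext <;> simp <;> ring
  zero_mul x := by ext <;> simp
  mul_zero x := by ext <;> simp
  mul_assoc x y z := by ext <;> simp <;> ring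
  one_mul x := by ext <;> simp
  mul_one x := by ext <;> simp
  mul_comm x y := by ext <;> simp <;> ring
  nsmul := nsmulRec
  zsmul := zsmulRec

/-- The norm `√(p₀² + p₁² + p₂² + p₃²)`. -/
noncomputable instance : Norm ReducedBiquaternion :=
  ⟨fun x => Real.sqrt (x.re ^ 2 + x.imI ^ 2 + x.imJ ^ 2 + x.imK ^ 2)⟩

/-- The complex number `r₁` in `x = r₁ + r₂ j`. -/
def fstC (x : ReducedBiquaternion) : ℂ := ⟨x.re, x.imI⟩

/-- The complex number `r₂` in `x = r₁ + r₂ j`. -/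
def sndC (x : ReducedBiquaternion) : ℂ := ⟨x.imJ, x.imK⟩

/-- The inclusion `ℂ → ℚ_ℝ`, `a + b i ↦ a + b i`. -/
def ofComplex (z : ℂ) : ReducedBiquaternion := ⟨z.re, z.im, 0, 0⟩

end ReducedBiquaternion

/-- The Frobenius norm `(∑ᵢⱼ ‖Mᵢⱼ‖²)^{1/2}`, for real, complex or reduced biquaternion entries. -/
noncomputable def frobNorm {ι κ α : Type*} [Fintype ι] [Fintype κ] [Norm α]
    (M : Matrix ι κ α) : ℝ :=
  Real.sqrt (∑ i, ∑ j, ‖M i j‖ ^ 2)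

open scoped Matrix.Norms.L2Operator in
/-- The matrix `2`-norm, i.e. the operator norm with respect to the Euclidean norms. -/
noncomputable def twoNorm {ι κ : Type*} [Fintype ι] [Fintype κ] [DecidableEq κ]
    (M : Matrix ι κ ℂ) : ℝ :=
  ‖M‖

/-- The four Penrose equations: `G` is the Moore-Penrose inverse of `M`. -/
structure IsMoorePenrose {ι κ : Type*} [Fintype ι] [Fintype κ]
    (M : Matrix ι κ ℂ) (G : Matrix κ ι ℂ) : Prop where
  mul_mul_self : M * G * M = M
  mul_mul_inv : G * M * G = G
  left_hermitian : (M * G)ᴴ = M * G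
  right_hermitian : (G * M)ᴴ = G * M

theorem IsMoorePenrose.unique {ι κ : Type*} [Fintype ι] [Fintype κ]
    {M : Matrix ι κ ℂ} {G H : Matrix κ ι ℂ}
    (hG : IsMoorePenrose M G) (hH : IsMoorePenrose M H) : G = H := by
  have h1 : M * G = M * H := by
    calc M * G = (M * G)ᴴ := hG.left_hermitian.symm
      _ = ((M * H) * (M * G))ᴴ := by rw [← Matrix.mul_assoc, hH.mul_mul_self]
      _ = (M * G)ᴴ * (M * H)ᴴ := Matrix.conjTranspose_mul _ _
      _ = (M * G * M) * H := by
        rw [hG.left_hermitian, hH.left_hermitian, Matrix.mul_assoc (M * G) M H]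
      _ = M * H := by rw [hG.mul_mul_self]
  have h2 : G * M = H * M := by
    calc G * M = (G * M)ᴴ := hG.right_hermitian.symm
      _ = ((G * M) * (H * M))ᴴ := by
        rw [Matrix.mul_assoc G M (H * M), ← Matrix.mul_assoc M H M, hH.mul_mul_self]
      _ = (H * M)ᴴ * (G * M)ᴴ := Matrix.conjTranspose_mul _ _
      _ = H * (M * G * M) := by
        rw [hG.right_hermitian, hH.right_hermitian]; simp only [Matrix.mul_assoc]
      _ = H * M := by rw [hG.mul_mul_self]
  calc G = G * M * G := hG.mul_mul_inv.symm
    _ = H * (M * G) := by rw [h2, Matrix.mul_assoc]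
    _ = H * M * H := by rw [h1, Matrix.mul_assoc]
    _ = H := hH.mul_mul_inv

open scoped ComplexOrder in
theorem exists_isMoorePenrose {ι κ : Type*} [Fintype ι] [Fintype κ]
    (M : Matrix ι κ ℂ) : ∃ G : Matrix κ ι ℂ, IsMoorePenrose M G := by
  classical
  have hH : (Mᴴ * M).IsHermitian := Matrix.isHermitian_conjTranspose_mul_self M
  obtain ⟨S, hS, hSH, hSS, hcomm⟩ : ∃ S : Matrix κ κ ℂ, (Mᴴ * M) * S * (Mᴴ * M) = Mᴴ * M ∧
      Sᴴ = S ∧ S * (Mᴴ * M) * S = S ∧ (Mᴴ * M) * S = S * (Mᴴ * M) := by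
    generalize Mᴴ * M = H at hH
    have hU := (Matrix.mem_unitaryGroup_iff').1 hH.eigenvectorUnitary.2
    have hs := hH.spectral_theorem
    rw [Unitary.conjStarAlgAut_apply] at hs
    set U : Matrix κ κ ℂ := (hH.eigenvectorUnitary : Matrix κ κ ℂ)
    set v : κ → ℂ := RCLike.ofReal ∘ hH.eigenvalues
    have hv : star v = v := by ext i; simp [v]
    have key : ∀ P Q : Matrix κ κ ℂ, (U * P * star U) * (U * Q * star U) = U * (P * Q) * star U := by
      intro P Q
      calc (U * P * star U) * (U * Q * star U) = U * P * (star U * U) * Q * star U := by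
            simp only [Matrix.mul_assoc]
        _ = U * (P * Q) * star U := by rw [hU]; simp only [Matrix.mul_assoc, Matrix.mul_one]
    have hinv : ∀ z : ℂ, z * z⁻¹ * z = z := mul_inv_mul_cancel
    refine ⟨U * Matrix.diagonal v⁻¹ * star U, ?_, ?_, ?_, ?_⟩
    · rw [hs, key, key, Matrix.diagonal_mul_diagonal, Matrix.diagonal_mul_diagonal]
      congr 3; ext i; simp
    · rw [Matrix.conjTranspose_mul, Matrix.conjTranspose_mul, Matrix.diagonal_conjTranspose,
        Matrix.star_eq_conjTranspose, Matrix.conjTranspose_conjTranspose, Matrix.mul_assoc]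
      congr 3; ext i
      have := congrFun hv i
      simp only [Pi.star_apply, Pi.inv_apply, star_inv₀] at this ⊢
      rw [this]
    · rw [hs, key, key, Matrix.diagonal_mul_diagonal, Matrix.diagonal_mul_diagonal]
      congr 3; ext i
      by_cases h : v i = 0 <;> simp [h]
    · rw [hs, key, key, Matrix.diagonal_mul_diagonal, Matrix.diagonal_mul_diagonal]
      congr 3; ext i; exact mul_comm _ _
  refine ⟨S * Mᴴ, ?_, ?_, ?_, ?_⟩
  · have h0 : (M * (S * (Mᴴ * M) - 1))ᴴ * (M * (S * (Mᴴ * M) - 1)) = 0 := by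
      rw [Matrix.conjTranspose_mul, Matrix.mul_assoc, ← Matrix.mul_assoc Mᴴ M, Matrix.mul_sub,
        Matrix.mul_one, ← Matrix.mul_assoc (Mᴴ * M) S, hS, sub_self, Matrix.mul_zero]
    have h1 := Matrix.conjTranspose_mul_self_eq_zero.1 h0
    rw [Matrix.mul_sub, Matrix.mul_one, sub_eq_zero] at h1
    simpa only [Matrix.mul_assoc] using h1
  · calc S * Mᴴ * M * (S * Mᴴ) = S * (Mᴴ * M) * S * Mᴴ := by simp only [Matrix.mul_assoc]
      _ = S * Mᴴ := by rw [hSS]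
  · rw [Matrix.conjTranspose_mul, Matrix.conjTranspose_mul, Matrix.conjTranspose_conjTranspose,
      hSH, Matrix.mul_assoc]
  · rw [Matrix.mul_assoc, Matrix.conjTranspose_mul, hSH, hH.eq, hcomm]

/-- The Moore-Penrose inverse. -/
noncomputable def pinv {ι κ : Type*} [Fintype ι] [Fintype κ] (M : Matrix ι κ ℂ) : Matrix κ ι ℂ :=
  Classical.choose (exists_isMoorePenrose M)

theorem pinv_spec {ι κ : Type*} [Fintype ι] [Fintype κ] (M : Matrix ι κ ℂ) :
    IsMoorePenrose M (pinv M) :=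
  Classical.choose_spec (exists_isMoorePenrose M)

/-- `M_c^C = [N₁; N₂]`, the first block column of the complex representation of
`M = N₁ + N₂ j`. -/
def complexCol {m n : ℕ} (M : Matrix (Fin m) (Fin n) ReducedBiquaternion) :
    Matrix (Fin m ⊕ Fin m) (Fin n) ℂ :=
  Matrix.fromRows (M.map ReducedBiquaternion.fstC) (M.map ReducedBiquaternion.sndC)

/-- A complex matrix regarded as a reduced biquaternion matrix. -/
def toRB {n d : ℕ} (X : Matrix (Fin n) (Fin d) ℂ) : Matrix (Fin n) (Fin d) ReducedBiquaternion :=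
  X.map ReducedBiquaternion.ofComplex

/-- `X` is a complex solution of the RBLSE problem: it minimizes `‖A X - B‖_F` over all complex
`n × d` matrices subject to `C X = D`. -/
def IsComplexRBLSESolution {m n p d : ℕ}
    (A : Matrix (Fin m) (Fin n) ReducedBiquaternion)
    (B : Matrix (Fin m) (Fin d) ReducedBiquaternion)
    (C : Matrix (Fin p) (Fin n) ReducedBiquaternion)
    (D : Matrix (Fin p) (Fin d) ReducedBiquaternion)
    (X : Matrix (Fin n) (Fin d) ℂ) : Prop :=
  C * toRB X = D ∧
    ∀ Y : Matrix (Fin n) (Fin d) ℂ, C * toRB Y = D →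
      frobNorm (A * toRB X - B) ≤ frobNorm (A * toRB Y - B)

section
variable {m n p : ℕ} (A : Matrix (Fin m) (Fin n) ReducedBiquaternion)
  (C : Matrix (Fin p) (Fin n) ReducedBiquaternion)

/-- `P_c = I - (C_c)† C_c`. -/
noncomputable def projC : Matrix (Fin n) (Fin n) ℂ :=
  1 - pinv (complexCol C) * complexCol C

/-- `L_c = (I - (A_c P_c)† A_c) (C_c)†`. -/
noncomputable def lmatC : Matrix (Fin n) (Fin p ⊕ Fin p) ℂ :=
  (1 - pinv (complexCol A * projC C) * complexCol A) * pinv (complexCol C)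

/-- `K_A = ‖C_c‖_F ‖L_c‖₂`. -/
noncomputable def condA : ℝ := frobNorm (complexCol C) * twoNorm (lmatC A C)

/-- `K_B = ‖A_c‖_F ‖(A_c P_c)†‖₂`. -/
noncomputable def condB : ℝ :=
  frobNorm (complexCol A) * twoNorm (pinv (complexCol A * projC C))

end

/-- `R_c = B_c - A_c X`. -/
noncomputable def residC {m n d : ℕ} (A : Matrix (Fin m) (Fin n) ReducedBiquaternion)
    (B : Matrix (Fin m) (Fin d) ReducedBiquaternion) (X : Matrix (Fin n) (Fin d) ℂ) :
    Matrix (Fin m ⊕ Fin m) (Fin d) ℂ :=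
  complexCol B - complexCol A * X

/-! Since `j` commutes with complex scalars, `complexCol` turns right multiplication by a complex
matrix into ordinary complex multiplication. It also preserves Frobenius norms, so the problem
becomes a complex equality constrained least squares problem.

There, uniqueness of the minimizer forces `ker A ∩ ker C = 0`. Together with full row rank of `C`
this makes the Karush-Kuhn-Tucker system `AᴴA X + CᴴΛ = AᴴB`, `C X = D` invertible, and `X` is its
first block. Subtracting the original equations from the perturbed ones leaves, with no truncation,
the unperturbed system for `(X' - X, Λ' - Λ)`. Write `P = kerProj C`, `G = (A P)†`, `L = (1 - G A)
C†`, and let `R'` be the perturbed residual. The first block then reads `X' - X = G Gᴴ (ΔAᴴ R' - ΔCᴴ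
Λ') + G (ΔB - ΔA X') + L (ΔD - ΔC X')` (`KerDisjoint.eq_of_kkt_system`, `IsKKT.stationary_sub`,
`IsKKT.feasible_sub`).

An absorption argument gives `X' - X, Λ' - Λ = O(ε)` (`KerDisjoint.exists_lipschitz`), so replacing
primed quantities by unprimed ones costs `O(ε²)`. The identity `Λ = (A L)ᴴ R`
(`IsKKT.multiplier_eq`) brings in `‖A L‖₂ ‖R‖_F`. The same absorption estimate, applied to zero
data, shows that the perturbed system stays invertible. -/

set_option linter.unusedSectionVars false

/-! ### Frobenius and spectral norms. -/

section FrobeniusNorm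

variable {ι κ τ : Type*} [Fintype ι] [Fintype κ] [Fintype τ]

open scoped Matrix.Norms.Frobenius in
theorem frobNorm_eq_norm (M : Matrix ι κ ℂ) : frobNorm M = ‖M‖ := by
  rw [Matrix.frobenius_norm_def, frobNorm, Real.sqrt_eq_rpow]
  simp

theorem frobNorm_nonneg {α : Type*} [Norm α] (M : Matrix ι κ α) : 0 ≤ frobNorm M :=
  Real.sqrt_nonneg _

open scoped Matrix.Norms.Frobenius in
theorem frobNorm_add_le (M N : Matrix ι κ ℂ) : frobNorm (M + N) ≤ frobNorm M + frobNorm N := by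
  simpa only [frobNorm_eq_norm] using norm_add_le M N

open scoped Matrix.Norms.Frobenius in
theorem frobNorm_sub_le (M N : Matrix ι κ ℂ) : frobNorm (M - N) ≤ frobNorm M + frobNorm N := by
  simpa only [frobNorm_eq_norm] using norm_sub_le M N

@[simp]
theorem frobNorm_zero : frobNorm (0 : Matrix ι κ ℂ) = 0 := by
  simp [frobNorm]

open scoped Matrix.Norms.Frobenius in
theorem frobNorm_eq_zero {M : Matrix ι κ ℂ} : frobNorm M = 0 ↔ M = 0 := by
  rw [frobNorm_eq_norm, norm_eq_zero]

open scoped Matrix.Norms.Frobenius in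
theorem frobNorm_mul_le (M : Matrix ι κ ℂ) (N : Matrix κ τ ℂ) :
    frobNorm (M * N) ≤ frobNorm M * frobNorm N := by
  simpa only [frobNorm_eq_norm] using Matrix.frobenius_norm_mul M N

open scoped Matrix.Norms.Frobenius in
theorem frobNorm_conjTranspose (M : Matrix ι κ ℂ) : frobNorm Mᴴ = frobNorm M := by
  simpa only [frobNorm_eq_norm] using Matrix.frobenius_norm_conjTranspose M

theorem frobNorm_sq {α : Type*} [Norm α] (M : Matrix ι κ α) :
    frobNorm M ^ 2 = ∑ i, ∑ j, ‖M i j‖ ^ 2 :=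
  Real.sq_sqrt (Finset.sum_nonneg fun _ _ => Finset.sum_nonneg fun _ _ => sq_nonneg _)

theorem frobNorm_sq_eq_trace (M : Matrix ι κ ℂ) :
    ((frobNorm M ^ 2 : ℝ) : ℂ) = (Mᴴ * M).trace := by
  rw [frobNorm_sq, Finset.sum_comm]
  simp only [Matrix.trace, Matrix.diag_apply, Matrix.mul_apply, Matrix.conjTranspose_apply]
  push_cast
  refine Finset.sum_congr rfl fun j _ => Finset.sum_congr rfl fun i _ => ?_
  rw [RCLike.star_def, mul_comm, Complex.mul_conj, Complex.normSq_eq_norm_sq]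
  push_cast
  rfl

theorem frobNorm_add_sq_of_orthogonal {M N : Matrix ι κ ℂ} (h : Mᴴ * N = 0) :
    frobNorm (M + N) ^ 2 = frobNorm M ^ 2 + frobNorm N ^ 2 := by
  have h' : Nᴴ * M = 0 := by
    simpa using congrArg Matrix.conjTranspose h
  have : ((frobNorm (M + N) ^ 2 : ℝ) : ℂ) = ((frobNorm M ^ 2 + frobNorm N ^ 2 : ℝ) : ℂ) := by
    rw [Complex.ofReal_add, frobNorm_sq_eq_trace, frobNorm_sq_eq_trace, frobNorm_sq_eq_trace,
      Matrix.conjTranspose_add, Matrix.add_mul, Matrix.mul_add, Matrix.mul_add, h, h', add_zero,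
      zero_add, Matrix.trace_add]
  exact_mod_cast this

open scoped Matrix.Norms.L2Operator in
theorem twoNorm_nonneg [DecidableEq κ] (M : Matrix ι κ ℂ) : 0 ≤ twoNorm M :=
  @norm_nonneg (Matrix ι κ ℂ) _ M

open scoped Matrix.Norms.L2Operator in
theorem twoNorm_conjTranspose [DecidableEq ι] [DecidableEq κ] (M : Matrix ι κ ℂ) :
    twoNorm Mᴴ = twoNorm M :=
  Matrix.l2_opNorm_conjTranspose M

open scoped Matrix.Norms.L2Operator in
@[simp]
theorem twoNorm_zero [DecidableEq κ] : twoNorm (0 : Matrix ι κ ℂ) = 0 :=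
  norm_zero

open scoped Matrix.Norms.L2Operator in
theorem frobNorm_mul_le_twoNorm_mul [DecidableEq κ] (M : Matrix ι κ ℂ) (N : Matrix κ τ ℂ) :
    frobNorm (M * N) ≤ twoNorm M * frobNorm N := by
  refine Real.sqrt_le_iff.2 ⟨mul_nonneg (twoNorm_nonneg M) (frobNorm_nonneg N), ?_⟩
  rw [mul_pow, frobNorm_sq, Finset.sum_comm, Finset.sum_comm (f := fun i j => ‖N i j‖ ^ 2),
    Finset.mul_sum]
  refine Finset.sum_le_sum fun j _ => ?_
  have h := Matrix.l2_opNorm_mulVec M (WithLp.toLp 2 fun k => N k j)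
  have h2 := pow_le_pow_left₀ (norm_nonneg _) h 2
  rw [mul_pow, EuclideanSpace.norm_sq_eq, EuclideanSpace.norm_sq_eq] at h2
  exact h2

end FrobeniusNorm

/-! ### Moore-Penrose identities for `A P`, with `P` the projection onto `ker C`. -/

section PseudoInverse

variable {ι κ τ : Type*} [Fintype ι] [Fintype κ] [Fintype τ]

theorem pinv_zero : pinv (0 : Matrix ι κ ℂ) = 0 :=
  (pinv_spec _).unique ⟨by simp, by simp, by simp, by simp⟩

/-- Full row rank gives some right inverse `E`, and then `C C† = C C† C E = C E = 1`. -/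
theorem mul_pinv_eq_one_of_rank_eq_card [DecidableEq ι] {C : Matrix ι κ ℂ}
    (hC : C.rank = Fintype.card ι) : C * pinv C = 1 := by
  have hsurj : Function.Surjective C.mulVecLin := by
    rw [← LinearMap.range_eq_top]
    apply Submodule.eq_top_of_finrank_eq
    rw [← Matrix.rank, hC, Module.finrank_fintype_fun_eq_card]
  choose g hg using hsurj
  have hE : C * (Matrix.of fun k i => g (Pi.single i 1) k) = 1 := by
    ext i j
    have := congrFun (hg (Pi.single j 1)) i
    rw [Matrix.mulVecLin_apply] at this
    rw [Matrix.one_apply, Matrix.mul_apply]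
    simpa [Matrix.mulVec, dotProduct, Pi.single_apply] using this
  calc C * pinv C = C * pinv C * (C * (Matrix.of fun k i => g (Pi.single i 1) k)) := by
        rw [hE, Matrix.mul_one]
    _ = 1 := by rw [← Matrix.mul_assoc, (pinv_spec C).mul_mul_self, hE]

theorem rank_eq_card_of_mul_eq_one [DecidableEq ι] {C : Matrix ι κ ℂ} {E : Matrix κ ι ℂ}
    (h : C * E = 1) : C.rank = Fintype.card ι := by
  refine le_antisymm (Matrix.rank_le_card_height C) ?_
  rw [← Matrix.rank_one (R := ℂ) (n := ι), ← h]
  exact Matrix.rank_mul_le_left C E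

/-- The orthogonal projection onto the kernel of `C`. -/
noncomputable def kerProj [DecidableEq κ] (C : Matrix τ κ ℂ) : Matrix κ κ ℂ :=
  1 - pinv C * C

/-- The linear part, in the right-hand side of the constraint, of the solution of the least
squares problem `min ‖A X - B‖` subject to `C X = D`. -/
noncomputable def constraintInv [DecidableEq κ] (A : Matrix ι κ ℂ) (C : Matrix τ κ ℂ) :
    Matrix κ τ ℂ :=
  (1 - pinv (A * kerProj C) * A) * pinv C

variable [DecidableEq κ] (A : Matrix ι κ ℂ) (C : Matrix τ κ ℂ)

theorem mul_kerProj : C * kerProj C = 0 := by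
  rw [kerProj, Matrix.mul_sub, Matrix.mul_one, ← Matrix.mul_assoc, (pinv_spec C).mul_mul_self,
    sub_self]

theorem conjTranspose_kerProj : (kerProj C)ᴴ = kerProj C := by
  rw [kerProj, Matrix.conjTranspose_sub, Matrix.conjTranspose_one, (pinv_spec C).right_hermitian]

theorem kerProj_mul_kerProj : kerProj C * kerProj C = kerProj C := by
  conv_lhs => enter [1]; rw [kerProj]
  rw [Matrix.sub_mul, Matrix.one_mul, Matrix.mul_assoc, mul_kerProj, Matrix.mul_zero, sub_zero]

/-- The range of `(A P)†` is that of `(A P)ᴴ = P Aᴴ`, which lies in the range of `P`. -/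
theorem kerProj_mul_pinv : kerProj C * pinv (A * kerProj C) = pinv (A * kerProj C) := by
  have h : pinv (A * kerProj C) =
      kerProj C * (Aᴴ * (pinv (A * kerProj C))ᴴ * pinv (A * kerProj C)) := by
    conv_lhs => rw [← (pinv_spec (A * kerProj C)).mul_mul_inv,
      ← (pinv_spec (A * kerProj C)).right_hermitian, Matrix.conjTranspose_mul,
      Matrix.conjTranspose_mul, conjTranspose_kerProj]
    simp only [Matrix.mul_assoc]
  rw [h, ← Matrix.mul_assoc, kerProj_mul_kerProj]

theorem mul_pinv_mul_kerProj : C * pinv (A * kerProj C) = 0 := by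
  rw [← kerProj_mul_pinv, ← Matrix.mul_assoc, mul_kerProj, Matrix.zero_mul]

theorem conjTranspose_pinv_mul_kerProj_mul :
    (pinv (A * kerProj C))ᴴ * Cᴴ = 0 := by
  rw [← Matrix.conjTranspose_mul, mul_pinv_mul_kerProj, Matrix.conjTranspose_zero]

/-- With `G = (A P)†`, `P G = G` makes `A G = A P G` a Hermitian projection, so `G (A G)ᴴ = G A P G
= G`. This lets terms `G Gᴴ Aᴴ Z` be estimated with a single factor `‖G‖₂`. -/
theorem pinv_mul_conjTranspose_pinv_mul :
    pinv (A * kerProj C) * (pinv (A * kerProj C))ᴴ * Aᴴ = pinv (A * kerProj C) := by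
  have h : A * pinv (A * kerProj C) = A * kerProj C * pinv (A * kerProj C) := by
    rw [Matrix.mul_assoc, kerProj_mul_pinv]
  rw [Matrix.mul_assoc, ← Matrix.conjTranspose_mul, h, (pinv_spec _).left_hermitian,
    ← Matrix.mul_assoc, (pinv_spec _).mul_mul_inv]

end PseudoInverse

/-! ### Optimality conditions and explicit solution of the Karush-Kuhn-Tucker system. -/

section Karush

variable {ι κ τ σ : Type*} [Fintype ι] [Fintype κ] [Fintype τ] [Fintype σ]

/-- The Karush-Kuhn-Tucker equations of `min ‖A X - B‖` subject to `C X = D`, with the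
multiplier `Λ`. -/
structure IsKKT (A : Matrix ι κ ℂ) (B : Matrix ι σ ℂ) (C : Matrix τ κ ℂ) (D : Matrix τ σ ℂ)
    (X : Matrix κ σ ℂ) (Λ : Matrix τ σ ℂ) : Prop where
  stationary : Aᴴ * (B - A * X) = Cᴴ * Λ
  feasible : C * X = D

/-- `X` minimizes `‖A X - B‖` subject to `C X = D`. -/
def IsLSESolution (A : Matrix ι κ ℂ) (B : Matrix ι σ ℂ) (C : Matrix τ κ ℂ) (D : Matrix τ σ ℂ)
    (X : Matrix κ σ ℂ) : Prop :=
  C * X = D ∧ ∀ Y : Matrix κ σ ℂ, C * Y = D → frobNorm (A * X - B) ≤ frobNorm (A * Y - B)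

/-- `A` and `C` have no common kernel vector. -/
def KerDisjoint (A : Matrix ι κ ℂ) (C : Matrix τ κ ℂ) : Prop :=
  ∀ v : κ → ℂ, A *ᵥ v = 0 → C *ᵥ v = 0 → v = 0

variable {A : Matrix ι κ ℂ} {B : Matrix ι σ ℂ} {C : Matrix τ κ ℂ} {D : Matrix τ σ ℂ}
  {X : Matrix κ σ ℂ} {Λ : Matrix τ σ ℂ}

theorem KerDisjoint.eq_zero (h : KerDisjoint A C) {Z : Matrix κ σ ℂ} (hA : A * Z = 0)
    (hC : C * Z = 0) : Z = 0 := by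
  have h0 : ∀ j, (fun k => Z k j) = 0 := fun j =>
    h _ (funext fun i => congrFun (congrFun hA i) j) (funext fun i => congrFun (congrFun hC i) j)
  ext k j
  exact congrFun (h0 j) k

/-- Pythagoras: `Aᴴ` maps the residual into the range of `Cᴴ`, which is orthogonal to `Y - X`
because `C (Y - X) = 0`. Minimality of `X` and, for disjoint kernels, its uniqueness follow. -/
theorem IsKKT.frobNorm_sq_eq (h : IsKKT A B C D X Λ) {Y : Matrix κ σ ℂ} (hY : C * Y = D) :
    frobNorm (A * Y - B) ^ 2 = frobNorm (A * (Y - X)) ^ 2 + frobNorm (A * X - B) ^ 2 := by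
  rw [← frobNorm_add_sq_of_orthogonal]
  · congr 2
    rw [Matrix.mul_sub]
    abel
  · have h1 : Aᴴ * (A * X - B) = -(Cᴴ * Λ) := by
      rw [← h.stationary, ← Matrix.mul_neg, neg_sub]
    rw [Matrix.conjTranspose_mul, Matrix.mul_assoc, h1, Matrix.mul_neg, ← Matrix.mul_assoc,
      ← Matrix.conjTranspose_mul, Matrix.mul_sub, hY, h.feasible, sub_self,
      Matrix.conjTranspose_zero, Matrix.zero_mul, neg_zero]

theorem IsKKT.isLSESolution (h : IsKKT A B C D X Λ) : IsLSESolution A B C D X := by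
  refine ⟨h.feasible, fun Y hY => ?_⟩
  have := h.frobNorm_sq_eq hY
  refine (sq_le_sq₀ (frobNorm_nonneg _) (frobNorm_nonneg _)).1 ?_
  nlinarith [sq_nonneg (frobNorm (A * (Y - X)))]

theorem IsKKT.eq_of_isLSESolution (h : IsKKT A B C D X Λ) (hAC : KerDisjoint A C)
    {Y : Matrix κ σ ℂ} (hY : IsLSESolution A B C D Y) : Y = X := by
  have h1 := h.frobNorm_sq_eq hY.1
  have h2 := pow_le_pow_left₀ (frobNorm_nonneg _) (hY.2 X h.feasible) 2
  have h3 : frobNorm (A * (Y - X)) = 0 :=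
    pow_eq_zero_iff two_ne_zero |>.1 (le_antisymm (by linarith) (sq_nonneg _))
  refine sub_eq_zero.1 (hAC.eq_zero (frobNorm_eq_zero.1 h3) ?_)
  rw [Matrix.mul_sub, hY.1, h.feasible, sub_self]

/-- Uniqueness of the minimizer forces the kernels of `A` and `C` to intersect trivially. -/
theorem IsLSESolution.kerDisjoint_of_unique [Nonempty σ] (hX : IsLSESolution A B C D X)
    (huniq : ∀ Y, IsLSESolution A B C D Y → Y = X) : KerDisjoint A C := by
  classical
  intro v hA hC
  -- A common kernel vector repeated in every column can be added to the minimizer without changing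
  -- constraint or residual. A nonempty column index is needed to recover `v` from `Z = 0`.
  let Z : Matrix κ σ ℂ := Matrix.of fun k _ => v k
  have hAZ : A * Z = 0 := by
    ext i j
    exact congrFun hA i
  have hCZ : C * Z = 0 := by
    ext i j
    exact congrFun hC i
  have h : X + Z = X := huniq _ ⟨by rw [Matrix.mul_add, hCZ, add_zero, hX.1], fun Y hY => by
    rw [Matrix.mul_add, hAZ, add_zero]
    exact hX.2 Y hY⟩
  have hZ : Z = 0 := by simpa using h
  ext k
  exact congrFun (congrFun hZ k) (Classical.arbitrary σ)

/-- The linear map of the Karush-Kuhn-Tucker system. -/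
def kktMap (σ : Type*) (A : Matrix ι κ ℂ) (C : Matrix τ κ ℂ) :
    (Matrix κ σ ℂ × Matrix τ σ ℂ) →ₗ[ℂ] (Matrix κ σ ℂ × Matrix τ σ ℂ) where
  toFun z := (Aᴴ * (A * z.1) + Cᴴ * z.2, C * z.1)
  map_add' y z := by
    ext <;> (simp [Matrix.mul_add]; try ring)
  map_smul' c z := by
    ext <;> simp

/-- If the homogeneous system has only the trivial solution, then the system is solvable. -/
theorem kktMap_surjective
    (h : ∀ (X : Matrix κ σ ℂ) (Λ : Matrix τ σ ℂ), Aᴴ * (A * X) + Cᴴ * Λ = 0 → C * X = 0 →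
      X = 0 ∧ Λ = 0) :
    Function.Surjective (kktMap σ A C) := by
  refine LinearMap.injective_iff_surjective.1 ((injective_iff_map_eq_zero _).2 fun z hz => ?_)
  obtain ⟨h1, h2⟩ := h z.1 z.2 (congrArg Prod.fst hz) (congrArg Prod.snd hz)
  exact Prod.ext h1 h2

theorem exists_isKKT (h : Function.Surjective (kktMap σ A C)) (B : Matrix ι σ ℂ)
    (D : Matrix τ σ ℂ) : ∃ X Λ, IsKKT A B C D X Λ := by
  obtain ⟨z, hz⟩ := h (Aᴴ * B, D)
  have h1 : Aᴴ * (A * z.1) + Cᴴ * z.2 = Aᴴ * B := congrArg Prod.fst hz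
  exact ⟨z.1, z.2, by rw [Matrix.mul_sub, ← h1, add_sub_cancel_left], congrArg Prod.snd hz⟩

variable [DecidableEq κ]

/-- The difference of the two sides is annihilated by `A`, by the first Penrose equation, and by
`C`, since both terms have range in `ker C`. -/
theorem KerDisjoint.pinv_mul_mul_kerProj (h : KerDisjoint A C) :
    pinv (A * kerProj C) * (A * kerProj C) = kerProj C := by
  refine sub_eq_zero.1 (h.eq_zero ?_ ?_)
  · rw [Matrix.mul_sub, ← Matrix.mul_assoc]
    conv_lhs => enter [1, 1]; rw [← kerProj_mul_pinv, ← Matrix.mul_assoc]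
    rw [(pinv_spec _).mul_mul_self, sub_self]
  · rw [Matrix.mul_sub, ← Matrix.mul_assoc, mul_pinv_mul_kerProj, Matrix.zero_mul, mul_kerProj,
      sub_zero]

/-- The first block of the solution of the Karush-Kuhn-Tucker system. -/
theorem KerDisjoint.eq_of_kkt_system (h : KerDisjoint A C) {F : Matrix κ σ ℂ}
    {G : Matrix τ σ ℂ} (h1 : Aᴴ * (A * X) + Cᴴ * Λ = F) (h2 : C * X = G) :
    X = pinv (A * kerProj C) * ((pinv (A * kerProj C))ᴴ * F) + constraintInv A C * G := by
  -- Writing `G = (A P)†`, the factor `Gᴴ` kills `CᴴΛ` because `C G = 0`, and `G Gᴴ Aᴴ = G`.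
  have e1 : pinv (A * kerProj C) * ((pinv (A * kerProj C))ᴴ * F)
      = pinv (A * kerProj C) * A * X := by
    rw [← h1, Matrix.mul_add, ← Matrix.mul_assoc _ Cᴴ, conjTranspose_pinv_mul_kerProj_mul,
      Matrix.zero_mul, add_zero, ← Matrix.mul_assoc, ← Matrix.mul_assoc,
      pinv_mul_conjTranspose_pinv_mul, Matrix.mul_assoc]
  -- `L C X = (1 - G A)(1 - P) X` with `G = (A P)†`, and `G A P = P` removes the `P` part.
  have e2 : constraintInv A C * G = X - pinv (A * kerProj C) * A * X := by
    have hP : pinv C * C = 1 - kerProj C := by rw [kerProj, sub_sub_cancel]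
    have h3 := h.pinv_mul_mul_kerProj
    rw [← Matrix.mul_assoc] at h3
    rw [← h2, constraintInv, ← Matrix.mul_assoc, Matrix.mul_assoc _ (pinv C) C, hP,
      Matrix.mul_sub, Matrix.mul_one, Matrix.sub_mul 1, Matrix.one_mul, h3, sub_self, sub_zero,
      Matrix.sub_mul, Matrix.one_mul]
  rw [e1, e2, add_sub_cancel]

theorem multiplier_eq_of_kkt_system [DecidableEq τ] (hC : C * pinv C = 1) {F : Matrix κ σ ℂ}
    (h1 : Aᴴ * (A * X) + Cᴴ * Λ = F) : Λ = (pinv C)ᴴ * (F - Aᴴ * (A * X)) := by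
  rw [← h1, add_sub_cancel_left, ← Matrix.mul_assoc, ← Matrix.conjTranspose_mul, hC,
    Matrix.conjTranspose_one, Matrix.one_mul]

theorem KerDisjoint.kkt_system_injective [DecidableEq τ] (h : KerDisjoint A C)
    (hC : C * pinv C = 1) (X : Matrix κ σ ℂ) (Λ : Matrix τ σ ℂ)
    (h1 : Aᴴ * (A * X) + Cᴴ * Λ = 0) (h2 : C * X = 0) : X = 0 ∧ Λ = 0 := by
  have hX : X = 0 := by
    rw [h.eq_of_kkt_system h1 h2]
    simp only [Matrix.mul_zero, add_zero]
  refine ⟨hX, ?_⟩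
  rw [multiplier_eq_of_kkt_system hC h1, hX]
  simp only [Matrix.mul_zero, sub_zero]

/-- Bounds the inverse of the unperturbed system through the explicit formulas for both blocks; `k`
feeds the absorption argument. -/
theorem KerDisjoint.exists_norm_le_of_kkt_system [DecidableEq τ] (h : KerDisjoint A C)
    (hC : C * pinv C = 1) (σ : Type*) [Fintype σ] :
    ∃ k : ℝ, 0 ≤ k ∧ ∀ (X F : Matrix κ σ ℂ) (Λ G : Matrix τ σ ℂ),
      Aᴴ * (A * X) + Cᴴ * Λ = F → C * X = G →
        frobNorm X + frobNorm Λ ≤ k * (frobNorm F + frobNorm G) := by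
  set g := frobNorm (pinv (A * kerProj C))
  set l := frobNorm (constraintInv A C)
  set c := frobNorm (pinv C)
  set a := frobNorm A
  have hg : 0 ≤ g := frobNorm_nonneg _
  have hl : 0 ≤ l := frobNorm_nonneg _
  have hc : 0 ≤ c := frobNorm_nonneg _
  have ha : 0 ≤ a := frobNorm_nonneg _
  refine ⟨(1 + c * a * a) * (g * g + l) + c, by positivity, fun X F Λ G h1 h2 => ?_⟩
  have hF := frobNorm_nonneg F
  have hG := frobNorm_nonneg G
  have hX : frobNorm X ≤ (g * g + l) * (frobNorm F + frobNorm G) := by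
    have e : frobNorm X ≤ g * (g * frobNorm F) + l * frobNorm G := by
      conv_lhs => rw [h.eq_of_kkt_system h1 h2]
      refine (frobNorm_add_le _ _).trans (add_le_add ((frobNorm_mul_le _ _).trans
        (mul_le_mul_of_nonneg_left ((frobNorm_mul_le _ _).trans_eq ?_) hg))
        (frobNorm_mul_le _ _))
      rw [frobNorm_conjTranspose]
    nlinarith [mul_nonneg (mul_nonneg hg hg) hG, mul_nonneg hl hF]
  have hΛ : frobNorm Λ ≤ c * (frobNorm F + a * (a * frobNorm X)) := by
    rw [multiplier_eq_of_kkt_system hC h1]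
    refine (frobNorm_mul_le _ _).trans ?_
    rw [frobNorm_conjTranspose]
    refine mul_le_mul_of_nonneg_left ((frobNorm_sub_le _ _).trans (add_le_add le_rfl
      ((frobNorm_mul_le _ _).trans ?_))) hc
    rw [frobNorm_conjTranspose]
    exact mul_le_mul_of_nonneg_left (frobNorm_mul_le _ _) ha
  have hcaa : 0 ≤ 1 + c * a * a := by positivity
  nlinarith [mul_le_mul_of_nonneg_left hX hcaa, mul_nonneg hc hG]

/-- The multiplier in terms of the residual. -/
theorem IsKKT.multiplier_eq [DecidableEq τ] (h : IsKKT A B C D X Λ) (hC : C * pinv C = 1) :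
    Λ = (A * constraintInv A C)ᴴ * (B - A * X) := by
  -- Because of this, the correction term of `L = (1 - G A) C†`, `G = (A P)†`, drops out: `Lᴴ Aᴴ R =
  -- (C†)ᴴ Aᴴ R = (C C†)ᴴ Λ = Λ`.
  have h0 : (pinv (A * kerProj C))ᴴ * (Aᴴ * (B - A * X)) = 0 := by
    rw [h.stationary, ← Matrix.mul_assoc, conjTranspose_pinv_mul_kerProj_mul, Matrix.zero_mul]
  have h1 : (constraintInv A C)ᴴ = (pinv C)ᴴ - (pinv C)ᴴ * Aᴴ * (pinv (A * kerProj C))ᴴ := by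
    rw [constraintInv, Matrix.conjTranspose_mul, Matrix.conjTranspose_sub,
      Matrix.conjTranspose_one, Matrix.conjTranspose_mul, Matrix.mul_sub, Matrix.mul_one,
      Matrix.mul_assoc]
  rw [Matrix.conjTranspose_mul, Matrix.mul_assoc, h1, Matrix.sub_mul, Matrix.mul_assoc _ _ (Aᴴ * _),
    h0, Matrix.mul_zero, sub_zero, h.stationary, ← Matrix.mul_assoc, ← Matrix.conjTranspose_mul,
    hC, Matrix.conjTranspose_one, Matrix.one_mul]

end Karush

/-! ### Perturbation of the Karush-Kuhn-Tucker system. -/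

section Perturbation

variable {ι κ τ σ : Type*} [Fintype ι] [Fintype κ] [Fintype τ] [Fintype σ]

variable {A ΔA : Matrix ι κ ℂ} {B ΔB : Matrix ι σ ℂ} {C ΔC : Matrix τ κ ℂ} {D ΔD : Matrix τ σ ℂ}
  {X X' : Matrix κ σ ℂ} {Λ Λ' : Matrix τ σ ℂ}

/-- The difference of two solutions solves the unperturbed system, exactly. -/
theorem IsKKT.stationary_sub (h : IsKKT A B C D X Λ)
    (h' : IsKKT (A + ΔA) (B + ΔB) (C + ΔC) (D + ΔD) X' Λ') :
    Aᴴ * (A * (X' - X)) + Cᴴ * (Λ' - Λ) =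
      ΔAᴴ * (B + ΔB - (A + ΔA) * X') - ΔCᴴ * Λ' + Aᴴ * (ΔB - ΔA * X') := by
  have e := h.stationary
  have e' := h'.stationary
  rw [Matrix.conjTranspose_add, Matrix.conjTranspose_add, Matrix.add_mul Aᴴ,
    Matrix.add_mul Cᴴ] at e'
  have e'' := eq_sub_of_add_eq e'.symm
  rw [Matrix.mul_sub Cᴴ, ← e, e'']
  simp only [Matrix.mul_sub, Matrix.mul_add, Matrix.add_mul]
  abel

theorem IsKKT.feasible_sub (h : IsKKT A B C D X Λ)
    (h' : IsKKT (A + ΔA) (B + ΔB) (C + ΔC) (D + ΔD) X' Λ') :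
    C * (X' - X) = ΔD - ΔC * X' := by
  have e' := h'.feasible
  rw [Matrix.add_mul] at e'
  rw [Matrix.mul_sub, h.feasible, eq_sub_of_add_eq e']
  abel

theorem frobNorm_le_add_frobNorm_sub (M N : Matrix κ σ ℂ) :
    frobNorm M ≤ frobNorm N + frobNorm (M - N) := by
  simpa using frobNorm_add_le N (M - N)

theorem frobNorm_mul_le_of_le {M : Matrix ι κ ℂ} {N : Matrix κ σ ℂ} {a b : ℝ}
    (hM : frobNorm M ≤ a) (hN : frobNorm N ≤ b) : frobNorm (M * N) ≤ a * b :=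
  (frobNorm_mul_le M N).trans
    (mul_le_mul hM hN (frobNorm_nonneg _) ((frobNorm_nonneg _).trans hM))

/-- The factor `2` combines `A (X' - X)` with `ΔA (X' - X)`, using `ε ≤ 1`. -/
theorem frobNorm_residual_sub_le {ε : ℝ} (hε1 : ε ≤ 1)
    (hA : frobNorm ΔA ≤ ε * frobNorm A) (hB : frobNorm ΔB ≤ ε * frobNorm B) :
    frobNorm (B + ΔB - (A + ΔA) * X' - (B - A * X)) ≤
      ε * (frobNorm B + frobNorm A * frobNorm X) + 2 * frobNorm A * frobNorm (X' - X) := by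
  have e : B + ΔB - (A + ΔA) * X' - (B - A * X) = ΔB - ΔA * X' - A * (X' - X) := by
    rw [Matrix.add_mul, Matrix.mul_sub]
    abel
  have h1 := frobNorm_mul_le_of_le hA (frobNorm_le_add_frobNorm_sub X' X)
  have h2 := frobNorm_mul_le A (X' - X)
  rw [e]
  have h3 := frobNorm_sub_le (ΔB - ΔA * X') (A * (X' - X))
  have h4 := frobNorm_sub_le ΔB (ΔA * X')
  have h5 := mul_le_mul_of_nonneg_right hε1
    (mul_nonneg (frobNorm_nonneg A) (frobNorm_nonneg (X' - X)))
  nlinarith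

variable [DecidableEq κ] [DecidableEq τ]

/-- A priori estimate: the solution and the multiplier depend on the data in a Lipschitz way near
`(A, B, C, D)`. The radius does not depend on `B` and `D`. -/
theorem KerDisjoint.exists_lipschitz (hAC : KerDisjoint A C) (hC : C * pinv C = 1)
    (σ : Type*) [Fintype σ] :
    ∃ ε₀ : ℝ, 0 < ε₀ ∧ ε₀ ≤ 1 ∧
      ∀ (B : Matrix ι σ ℂ) (D : Matrix τ σ ℂ) (X : Matrix κ σ ℂ) (Λ : Matrix τ σ ℂ),
      IsKKT A B C D X Λ →
      ∃ k : ℝ, 0 ≤ k ∧ (B = 0 → D = 0 → X = 0 → Λ = 0 → k = 0) ∧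
      ∀ (ε : ℝ) (ΔA : Matrix ι κ ℂ) (ΔB : Matrix ι σ ℂ) (ΔC : Matrix τ κ ℂ) (ΔD : Matrix τ σ ℂ)
        (X' : Matrix κ σ ℂ) (Λ' : Matrix τ σ ℂ), 0 ≤ ε → ε ≤ ε₀ →
        frobNorm ΔA ≤ ε * frobNorm A → frobNorm ΔB ≤ ε * frobNorm B →
        frobNorm ΔC ≤ ε * frobNorm C → frobNorm ΔD ≤ ε * frobNorm D →
        IsKKT (A + ΔA) (B + ΔB) (C + ΔC) (D + ΔD) X' Λ' →
        frobNorm (X' - X) + frobNorm (Λ' - Λ) ≤ k * ε := by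
  obtain ⟨k₀, hk₀, hk⟩ := hAC.exists_norm_le_of_kkt_system hC σ
  set a := frobNorm A with ha
  set c := frobNorm C with hc
  have ha0 : 0 ≤ a := frobNorm_nonneg _
  have hc0 : 0 ≤ c := frobNorm_nonneg _
  -- `ε W` bounds the coefficients of the unknown errors `s`, `t` in the right-hand sides: `2a² +
  -- a²` from the residual and from `Aᴴ ΔA X'`, and `c` from each of `ΔCᴴ Λ'` and `ΔC X'`.
  obtain ⟨W, hW⟩ : ∃ W : ℝ, W = 3 * a * a + 2 * c := ⟨_, rfl⟩
  have hW0 : 0 ≤ W := hW ▸ by positivity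
  have hkW : 1 ≤ 2 * k₀ * W + 1 := by linarith [mul_nonneg hk₀ hW0]
  -- This radius ensures `ε ≤ 1` and `k₀ ε W ≤ 1/2`, so half of `s + t` can be absorbed on the left.
  refine ⟨(2 * k₀ * W + 1)⁻¹, by positivity, inv_le_one_of_one_le₀ hkW,
    fun B D X Λ h => ?_⟩
  set b := frobNorm B with hb
  set d := frobNorm D with hd
  set x := frobNorm X with hx
  set y := frobNorm Λ with hy
  have hb0 : 0 ≤ b := frobNorm_nonneg _
  have hd0 : 0 ≤ d := frobNorm_nonneg _
  have hx0 : 0 ≤ x := frobNorm_nonneg _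
  have hy0 : 0 ≤ y := frobNorm_nonneg _
  set r := frobNorm (B - A * X) with hr
  have hr0 : 0 ≤ r := frobNorm_nonneg _
  -- `Q` collects the terms free of `s` and `t`; absorption doubles it, whence the constant `2 k₀
  -- Q`.
  obtain ⟨Q, hQ⟩ : ∃ Q : ℝ, Q = a * (r + b + a * x) + c * y + a * (b + a * x) + d + c * x :=
    ⟨_, rfl⟩
  have hQ0 : 0 ≤ Q := hQ ▸ by positivity
  refine ⟨2 * k₀ * Q, by positivity, ?_, ?_⟩
  · rintro rfl rfl rfl rfl
    simp [hQ, hr, hb, hd, hx, hy]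
  intro ε ΔA ΔB ΔC ΔD X' Λ' hε hε0 hA hB hC' hD h'
  have hε1 : ε ≤ 1 := hε0.trans (inv_le_one_of_one_le₀ hkW)
  have hεW : ε * (2 * k₀ * W) ≤ 1 := by
    have h1 : ε * (2 * k₀ * W + 1) ≤ 1 := by
      rw [← le_div_iff₀ (by positivity), one_div]
      exact hε0
    linarith
  set s := frobNorm (X' - X) with hs
  set t := frobNorm (Λ' - Λ) with ht
  have hs0 : 0 ≤ s := frobNorm_nonneg _
  have ht0 : 0 ≤ t := frobNorm_nonneg _
  have hX' : frobNorm X' ≤ x + s := frobNorm_le_add_frobNorm_sub _ _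
  have hΛ' : frobNorm Λ' ≤ y + t := frobNorm_le_add_frobNorm_sub _ _
  have hR : frobNorm (B + ΔB - (A + ΔA) * X') ≤ r + (ε * (b + a * x) + 2 * a * s) :=
    (frobNorm_le_add_frobNorm_sub _ (B - A * X)).trans
      (add_le_add le_rfl (frobNorm_residual_sub_le hε1 hA hB))
  have hR' : frobNorm (B + ΔB - (A + ΔA) * X') ≤ r + b + a * x + 2 * a * s := by
    linarith [mul_le_mul_of_nonneg_right hε1 (add_nonneg hb0 (mul_nonneg ha0 hx0))]
  have hmain := hk _ _ _ _ (h.stationary_sub h') (h.feasible_sub h')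
  have f1 : frobNorm (ΔAᴴ * (B + ΔB - (A + ΔA) * X')) ≤ ε * a * (r + b + a * x + 2 * a * s) :=
    frobNorm_mul_le_of_le (by rwa [frobNorm_conjTranspose]) hR'
  have f2 : frobNorm (ΔCᴴ * Λ') ≤ ε * c * (y + t) :=
    frobNorm_mul_le_of_le (by rwa [frobNorm_conjTranspose]) hΛ'
  have f3 : frobNorm (ΔB - ΔA * X') ≤ ε * b + ε * a * (x + s) :=
    (frobNorm_sub_le _ _).trans (add_le_add hB (frobNorm_mul_le_of_le hA hX'))
  have f4 : frobNorm (Aᴴ * (ΔB - ΔA * X')) ≤ a * (ε * b + ε * a * (x + s)) :=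
    frobNorm_mul_le_of_le (by rw [frobNorm_conjTranspose]) f3
  have f5 : frobNorm (ΔD - ΔC * X') ≤ ε * d + ε * c * (x + s) :=
    (frobNorm_sub_le _ _).trans (add_le_add hD (frobNorm_mul_le_of_le hC' hX'))
  have f6 := (frobNorm_add_le (ΔAᴴ * (B + ΔB - (A + ΔA) * X') - ΔCᴴ * Λ')
    (Aᴴ * (ΔB - ΔA * X'))).trans (add_le_add (frobNorm_sub_le _ _) le_rfl)
  have f7 : frobNorm (ΔAᴴ * (B + ΔB - (A + ΔA) * X') - ΔCᴴ * Λ' + Aᴴ * (ΔB - ΔA * X'))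
      + frobNorm (ΔD - ΔC * X') ≤ ε * (Q + W * (s + t)) := by
    have g1 : 0 ≤ ε * (c * s) := by positivity
    have g2 : 0 ≤ ε * (c * t) := by positivity
    have g3 : 0 ≤ ε * (a * a * t) := by positivity
    have e : ε * (Q + W * (s + t)) = ε * a * (r + b + a * x + 2 * a * s) + ε * c * (y + t)
        + a * (ε * b + ε * a * (x + s)) + (ε * d + ε * c * (x + s))
        + (ε * (c * s) + ε * (c * t) + 3 * (ε * (a * a * t))) := by
      rw [hQ, hW]
      ring
    linarith
  have f8 : s + t ≤ k₀ * (ε * (Q + W * (s + t))) :=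
    hmain.trans (mul_le_mul_of_nonneg_left f7 hk₀)
  have f9 := mul_le_mul_of_nonneg_right hεW (add_nonneg hs0 ht0)
  linarith

/-- The perturbed homogeneous Karush-Kuhn-Tucker system has only the trivial solution. -/
theorem KerDisjoint.exists_perturbed_injective (hAC : KerDisjoint A C) (hC : C * pinv C = 1)
    (σ : Type*) [Fintype σ] :
    ∃ ε₀ : ℝ, 0 < ε₀ ∧ ∀ (ε : ℝ) (ΔA : Matrix ι κ ℂ) (ΔC : Matrix τ κ ℂ), 0 ≤ ε → ε ≤ ε₀ →
      frobNorm ΔA ≤ ε * frobNorm A → frobNorm ΔC ≤ ε * frobNorm C →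
      ∀ (X : Matrix κ σ ℂ) (Λ : Matrix τ σ ℂ),
        (A + ΔA)ᴴ * ((A + ΔA) * X) + (C + ΔC)ᴴ * Λ = 0 → (C + ΔC) * X = 0 → X = 0 ∧ Λ = 0 := by
  obtain ⟨ε₀, hε₀, -, H⟩ := hAC.exists_lipschitz hC σ
  -- A homogeneous perturbed solution is a Karush-Kuhn-Tucker point with zero data near the zero
  -- point. There the Lipschitz constant is `0`, so it vanishes.
  obtain ⟨k, -, hk, H⟩ := H 0 0 0 0 ⟨by simp only [Matrix.mul_zero, sub_zero], Matrix.mul_zero _⟩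
  obtain rfl := hk rfl rfl rfl rfl
  refine ⟨ε₀, hε₀, fun ε ΔA ΔC h0 h1 hA hC X Λ e1 e2 => ?_⟩
  have := H ε ΔA 0 ΔC 0 X Λ h0 h1 hA (by simp) hC (by simp) ⟨by
      rw [zero_add, zero_sub, Matrix.mul_neg, neg_eq_of_add_eq_zero_right e1], by
      rw [e2, add_zero]⟩
  rw [sub_zero, sub_zero, zero_mul] at this
  have hX := frobNorm_nonneg X
  have hΛ := frobNorm_nonneg Λ
  exact ⟨frobNorm_eq_zero.1 (by linarith), frobNorm_eq_zero.1 (by linarith)⟩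

/-- The common kernel stays trivial and the constraint matrix keeps full row rank under small
perturbations, and the perturbed system is solvable. -/
theorem KerDisjoint.exists_perturbed_wellPosed (hAC : KerDisjoint A C) (hC : C * pinv C = 1)
    (σ : Type*) [Fintype σ] :
    ∃ ε₀ : ℝ, 0 < ε₀ ∧ ∀ (ε : ℝ) (ΔA : Matrix ι κ ℂ) (ΔC : Matrix τ κ ℂ), 0 ≤ ε → ε ≤ ε₀ →
      frobNorm ΔA ≤ ε * frobNorm A → frobNorm ΔC ≤ ε * frobNorm C →
      KerDisjoint (A + ΔA) (C + ΔC) ∧ (C + ΔC).rank = Fintype.card τ ∧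
        Function.Surjective (kktMap σ (A + ΔA) (C + ΔC)) := by
  obtain ⟨ε₁, h₁, H₁⟩ := hAC.exists_perturbed_injective hC Unit
  obtain ⟨ε₂, h₂, H₂⟩ := hAC.exists_perturbed_injective hC τ
  obtain ⟨ε₃, h₃, H₃⟩ := hAC.exists_perturbed_injective hC σ
  -- One radius per column type: `Unit` for kernel vectors, `τ` for a right inverse of `C + ΔC`, `σ`
  -- for solvability.
  refine ⟨min ε₁ (min ε₂ ε₃), by positivity, fun ε ΔA ΔC h0 hε hA hC => ⟨?_, ?_, ?_⟩⟩
  · intro v hv hv'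
    have e1 : (A + ΔA) * Matrix.replicateCol Unit v = 0 := by
      ext i j
      exact congrFun hv i
    have e2 : (C + ΔC) * Matrix.replicateCol Unit v = 0 := by
      ext i j
      exact congrFun hv' i
    have := (H₁ ε ΔA ΔC h0 (hε.trans (min_le_left _ _)) hA hC (Matrix.replicateCol Unit v) 0
      (by rw [e1, Matrix.mul_zero, Matrix.mul_zero, add_zero]) e2).1
    ext k
    exact congrFun (congrFun this k) ()
  · obtain ⟨z, hz⟩ := kktMap_surjective (H₂ ε ΔA ΔC h0
      (hε.trans ((min_le_right _ _).trans (min_le_left _ _))) hA hC) (0, 1)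
    exact rank_eq_card_of_mul_eq_one (E := z.1) (congrArg Prod.snd hz)
  · exact kktMap_surjective (H₃ ε ΔA ΔC h0
      (hε.trans ((min_le_right _ _).trans (min_le_right _ _))) hA hC)

/-- First-order perturbation bound for the solution of the equality constrained least squares
problem. -/
theorem IsKKT.exists_frobNorm_sub_le [DecidableEq ι] (h : IsKKT A B C D X Λ)
    (hAC : KerDisjoint A C) (hC : C * pinv C = 1) :
    ∃ k : ℝ, 0 ≤ k ∧ ∃ ε₀ : ℝ, 0 < ε₀ ∧
      ∀ (ε : ℝ) (ΔA : Matrix ι κ ℂ) (ΔB : Matrix ι σ ℂ) (ΔC : Matrix τ κ ℂ) (ΔD : Matrix τ σ ℂ)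
        (X' : Matrix κ σ ℂ) (Λ' : Matrix τ σ ℂ), 0 ≤ ε → ε ≤ ε₀ →
        frobNorm ΔA ≤ ε * frobNorm A → frobNorm ΔB ≤ ε * frobNorm B →
        frobNorm ΔC ≤ ε * frobNorm C → frobNorm ΔD ≤ ε * frobNorm D →
        IsKKT (A + ΔA) (B + ΔB) (C + ΔC) (D + ΔD) X' Λ' →
        frobNorm (X' - X) ≤
          ε * (twoNorm (constraintInv A C) * (frobNorm D + frobNorm C * frobNorm X)
            + twoNorm (pinv (A * kerProj C)) * (frobNorm B + frobNorm A * frobNorm X)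
            + twoNorm (pinv (A * kerProj C)) ^ 2 *
              (frobNorm C * twoNorm (A * constraintInv A C) + frobNorm A) *
              frobNorm (B - A * X)) + k * ε ^ 2 := by
  obtain ⟨ε₀, hε₀, hε₀1, H⟩ := hAC.exists_lipschitz hC σ
  obtain ⟨k, hk, -, H⟩ := H B D X Λ h
  have hΛ : frobNorm Λ ≤ twoNorm (A * constraintInv A C) * frobNorm (B - A * X) := by
    conv_lhs => rw [h.multiplier_eq hC]
    rw [← twoNorm_conjTranspose]
    exact frobNorm_mul_le_twoNorm_mul _ _
  set a := frobNorm A with ha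
  set c := frobNorm C with hc
  set b := frobNorm B with hb
  set d := frobNorm D with hd
  set x := frobNorm X with hx
  set r := frobNorm (B - A * X) with hr
  set l := twoNorm (constraintInv A C) with hl
  set g := twoNorm (pinv (A * kerProj C)) with hg
  set q := twoNorm (A * constraintInv A C) with hq
  have ha0 : 0 ≤ a := frobNorm_nonneg _
  have hc0 : 0 ≤ c := frobNorm_nonneg _
  have hb0 : 0 ≤ b := frobNorm_nonneg _
  have hx0 : 0 ≤ x := frobNorm_nonneg _
  have hl0 : 0 ≤ l := twoNorm_nonneg _
  have hg0 : 0 ≤ g := twoNorm_nonneg _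
  -- Lipschitz constant of the residual, used to replace the perturbed residual by the original one.
  set k' : ℝ := b + a * x + 2 * a * k with hk'
  refine ⟨g * (g * (a * k' + c * k)) + g * (a * k) + l * (c * k), by positivity, ε₀, hε₀, ?_⟩
  intro ε ΔA ΔB ΔC ΔD X' Λ' h0 hε hA hB hC' hD h'
  have hst := H ε ΔA ΔB ΔC ΔD X' Λ' h0 hε hA hB hC' hD h'
  have hs : frobNorm (X' - X) ≤ k * ε := by linarith [frobNorm_nonneg (Λ' - Λ)]
  have ht : frobNorm (Λ' - Λ) ≤ k * ε := by linarith [frobNorm_nonneg (X' - X)]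
  have hX' : frobNorm X' ≤ x + k * ε :=
    (frobNorm_le_add_frobNorm_sub _ X).trans (add_le_add le_rfl hs)
  have hΛ' : frobNorm Λ' ≤ q * r + k * ε :=
    (frobNorm_le_add_frobNorm_sub _ Λ).trans (add_le_add hΛ ht)
  have hR : frobNorm (B + ΔB - (A + ΔA) * X') ≤ r + k' * ε := by
    refine (frobNorm_le_add_frobNorm_sub _ (B - A * X)).trans (add_le_add le_rfl
      ((frobNorm_residual_sub_le (hε.trans hε₀1) hA hB).trans ?_))
    rw [hk']
    nlinarith [mul_le_mul_of_nonneg_left hs ha0]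
  have f1 : frobNorm (ΔAᴴ * (B + ΔB - (A + ΔA) * X') - ΔCᴴ * Λ') ≤
      ε * a * (r + k' * ε) + ε * c * (q * r + k * ε) :=
    (frobNorm_sub_le _ _).trans (add_le_add
      (frobNorm_mul_le_of_le (by rwa [frobNorm_conjTranspose]) hR)
      (frobNorm_mul_le_of_le (by rwa [frobNorm_conjTranspose]) hΛ'))
  have f2 : frobNorm (ΔB - ΔA * X') ≤ ε * b + ε * a * (x + k * ε) :=
    (frobNorm_sub_le _ _).trans (add_le_add hB (frobNorm_mul_le_of_le hA hX'))
  have f3 : frobNorm (ΔD - ΔC * X') ≤ ε * d + ε * c * (x + k * ε) :=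
    (frobNorm_sub_le _ _).trans (add_le_add hD (frobNorm_mul_le_of_le hC' hX'))
  have e := hAC.eq_of_kkt_system (h.stationary_sub h') (h.feasible_sub h')
  -- Collapsing `G Gᴴ Aᴴ` to `G`, with `G = (A P)†`, makes the `ΔB - ΔA X'` term linear in `‖G‖₂`.
  rw [Matrix.mul_add, Matrix.mul_add, ← Matrix.mul_assoc (pinv (A * kerProj C)) _ (Aᴴ * _),
    ← Matrix.mul_assoc _ Aᴴ, pinv_mul_conjTranspose_pinv_mul] at e
  rw [e]
  have g1 : frobNorm (pinv (A * kerProj C) * ((pinv (A * kerProj C))ᴴ *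
      (ΔAᴴ * (B + ΔB - (A + ΔA) * X') - ΔCᴴ * Λ'))) ≤
      g * (g * (ε * a * (r + k' * ε) + ε * c * (q * r + k * ε))) := by
    refine (frobNorm_mul_le_twoNorm_mul _ _).trans (mul_le_mul_of_nonneg_left
      ((frobNorm_mul_le_twoNorm_mul _ _).trans ?_) hg0)
    rw [twoNorm_conjTranspose]
    exact mul_le_mul_of_nonneg_left f1 hg0
  have g2 : frobNorm (pinv (A * kerProj C) * (ΔB - ΔA * X')) ≤
      g * (ε * b + ε * a * (x + k * ε)) :=
    (frobNorm_mul_le_twoNorm_mul _ _).trans (mul_le_mul_of_nonneg_left f2 hg0)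
  have g3 : frobNorm (constraintInv A C * (ΔD - ΔC * X')) ≤ l * (ε * d + ε * c * (x + k * ε)) :=
    (frobNorm_mul_le_twoNorm_mul _ _).trans (mul_le_mul_of_nonneg_left f3 hl0)
  refine (frobNorm_add_le _ _).trans ((add_le_add ((frobNorm_add_le _ _).trans
    (add_le_add g1 g2)) g3).trans_eq ?_)
  ring

end Perturbation

/-! ### Passage from reduced biquaternion to complex matrices. -/

section ReducedBiquaternion

variable {m n d : ℕ}

theorem complexCol_injective : Function.Injective
    (complexCol : Matrix (Fin m) (Fin n) ReducedBiquaternion → _) := by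
  intro M N h
  ext i j
  · exact congrArg Complex.re (congrFun (congrFun h (Sum.inl i)) j)
  · exact congrArg Complex.im (congrFun (congrFun h (Sum.inl i)) j)
  · exact congrArg Complex.re (congrFun (congrFun h (Sum.inr i)) j)
  · exact congrArg Complex.im (congrFun (congrFun h (Sum.inr i)) j)

theorem complexCol_add (M N : Matrix (Fin m) (Fin n) ReducedBiquaternion) :
    complexCol (M + N) = complexCol M + complexCol N := by
  ext (i | i) j <;> rfl

theorem complexCol_sub (M N : Matrix (Fin m) (Fin n) ReducedBiquaternion) :
    complexCol (M - N) = complexCol M - complexCol N := by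
  rw [eq_sub_iff_add_eq, ← complexCol_add, sub_add_cancel]

theorem frobNorm_complexCol (M : Matrix (Fin m) (Fin n) ReducedBiquaternion) :
    frobNorm (complexCol M) = frobNorm M := by
  unfold frobNorm
  congr 1
  rw [Fintype.sum_sum_type, ← Finset.sum_add_distrib]
  refine Finset.sum_congr rfl fun i _ => ?_
  rw [← Finset.sum_add_distrib]
  refine Finset.sum_congr rfl fun j _ => ?_
  have h : ‖M i j‖ ^ 2 = (M i j).re ^ 2 + (M i j).imI ^ 2 + (M i j).imJ ^ 2 + (M i j).imK ^ 2 :=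
    Real.sq_sqrt (by positivity)
  rw [h, ← Complex.normSq_eq_norm_sq, ← Complex.normSq_eq_norm_sq, Complex.normSq_apply,
    Complex.normSq_apply]
  simp only [complexCol, Matrix.fromRows_apply_inl, Matrix.fromRows_apply_inr, Matrix.map_apply,
    ReducedBiquaternion.fstC, ReducedBiquaternion.sndC]
  ring

/-- `x ↦ r₁` in `x = r₁ + r₂ j`, as an additive map. -/
def ReducedBiquaternion.fstCHom : ReducedBiquaternion →+ ℂ where
  toFun := fstC
  map_zero' := rfl
  map_add' _ _ := rfl

/-- `x ↦ r₂` in `x = r₁ + r₂ j`, as an additive map. -/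
def ReducedBiquaternion.sndCHom : ReducedBiquaternion →+ ℂ where
  toFun := sndC
  map_zero' := rfl
  map_add' _ _ := rfl

theorem ReducedBiquaternion.fstC_mul_ofComplex (x : ReducedBiquaternion) (z : ℂ) :
    (x * ofComplex z).fstC = x.fstC * z := by
  apply Complex.ext <;> simp [fstC, ofComplex]

theorem ReducedBiquaternion.sndC_mul_ofComplex (x : ReducedBiquaternion) (z : ℂ) :
    (x * ofComplex z).sndC = x.sndC * z := by
  apply Complex.ext <;> simp [sndC, ofComplex, add_comm]

theorem complexCol_mul_toRB (M : Matrix (Fin m) (Fin n) ReducedBiquaternion)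
    (X : Matrix (Fin n) (Fin d) ℂ) : complexCol (M * toRB X) = complexCol M * X := by
  ext (i | i) j
  · exact (map_sum ReducedBiquaternion.fstCHom _ _).trans
      (Finset.sum_congr rfl fun k _ => ReducedBiquaternion.fstC_mul_ofComplex _ _)
  · exact (map_sum ReducedBiquaternion.sndCHom _ _).trans
      (Finset.sum_congr rfl fun k _ => ReducedBiquaternion.sndC_mul_ofComplex _ _)

theorem isComplexRBLSESolution_iff {p : ℕ} {A : Matrix (Fin m) (Fin n) ReducedBiquaternion}
    {B : Matrix (Fin m) (Fin d) ReducedBiquaternion}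
    {C : Matrix (Fin p) (Fin n) ReducedBiquaternion}
    {D : Matrix (Fin p) (Fin d) ReducedBiquaternion} {X : Matrix (Fin n) (Fin d) ℂ} :
    IsComplexRBLSESolution A B C D X ↔
      IsLSESolution (complexCol A) (complexCol B) (complexCol C) (complexCol D) X := by
  simp only [IsComplexRBLSESolution, IsLSESolution, ← complexCol_mul_toRB,
    complexCol_injective.eq_iff, ← complexCol_sub, frobNorm_complexCol]

end ReducedBiquaternion

/-- First-order normwise perturbation bound for the complex solution of the RBLSE problem. The
hypotheses `hX`, `huniq` say that `X` is *the* complex solution. -/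
theorem theorem4p7 {m n p d : ℕ}
    (A : Matrix (Fin m) (Fin n) ReducedBiquaternion)
    (B : Matrix (Fin m) (Fin d) ReducedBiquaternion)
    (C : Matrix (Fin p) (Fin n) ReducedBiquaternion)
    (D : Matrix (Fin p) (Fin d) ReducedBiquaternion)
    (hmn : n + d ≤ m)
    (hC : (complexCol C).rank = 2 * p)
    (X : Matrix (Fin n) (Fin d) ℂ)
    (hX : IsComplexRBLSESolution A B C D X)
    (huniq : ∀ Y, IsComplexRBLSESolution A B C D Y → Y = X)
    (hX0 : X ≠ 0) :
    ∃ K : ℝ, 0 ≤ K ∧ ∃ ε₀ : ℝ, 0 < ε₀ ∧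
      ∀ (ε : ℝ) (ΔA : Matrix (Fin m) (Fin n) ReducedBiquaternion)
        (ΔB : Matrix (Fin m) (Fin d) ReducedBiquaternion)
        (ΔC : Matrix (Fin p) (Fin n) ReducedBiquaternion)
        (ΔD : Matrix (Fin p) (Fin d) ReducedBiquaternion),
        0 ≤ ε → ε ≤ ε₀ →
        frobNorm ΔA ≤ ε * frobNorm A → frobNorm ΔB ≤ ε * frobNorm B →
        frobNorm ΔC ≤ ε * frobNorm C → frobNorm ΔD ≤ ε * frobNorm D →
        (complexCol (C + ΔC)).rank = 2 * p ∧
        (∃! X' : Matrix (Fin n) (Fin d) ℂ,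
          IsComplexRBLSESolution (A + ΔA) (B + ΔB) (C + ΔC) (D + ΔD) X') ∧
        ∀ X' : Matrix (Fin n) (Fin d) ℂ,
          IsComplexRBLSESolution (A + ΔA) (B + ΔB) (C + ΔC) (D + ΔD) X' →
          frobNorm (X' - X) / frobNorm X ≤
            ε * (condA A C *
                  (frobNorm (complexCol D) / (frobNorm (complexCol C) * frobNorm X) + 1)
                + condB A C *
                  (frobNorm (complexCol B) / (frobNorm (complexCol A) * frobNorm X) + 1)
                + condB A C ^ 2 *
                  (frobNorm (complexCol C) / frobNorm (complexCol A)
                    * twoNorm (complexCol A * lmatC A C) + 1)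
                  * (frobNorm (residC A B X) / (frobNorm (complexCol A) * frobNorm X)))
              + K * ε ^ 2 := by
  -- `X ≠ 0` excludes `d = 0`, as required to deduce disjoint kernels from uniqueness.
  have hd : Nonempty (Fin d) := by
    by_contra hd
    rw [not_nonempty_iff] at hd
    exact hX0 (Matrix.ext fun _ j => isEmptyElim j)
  have hcard : Fintype.card (Fin p ⊕ Fin p) = 2 * p := by simp [two_mul]
  have hsol : IsLSESolution (complexCol A) (complexCol B) (complexCol C) (complexCol D) X :=
    isComplexRBLSESolution_iff.1 hX
  have hC1 : complexCol C * pinv (complexCol C) = 1 :=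
    mul_pinv_eq_one_of_rank_eq_card (hC.trans hcard.symm)
  have hAC : KerDisjoint (complexCol A) (complexCol C) :=
    hsol.kerDisjoint_of_unique fun Y hY => huniq Y (isComplexRBLSESolution_iff.2 hY)
  obtain ⟨Λ, h⟩ : ∃ Λ, IsKKT (complexCol A) (complexCol B) (complexCol C) (complexCol D) X Λ := by
    obtain ⟨Y, Λ, h⟩ := exists_isKKT (kktMap_surjective (hAC.kkt_system_injective hC1))
      (complexCol B) (complexCol D)
    -- The system has a solution, and its first block is the only minimizer; hence the given `X` has
    -- a multiplier.
    obtain rfl := h.eq_of_isLSESolution hAC hsol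
    exact ⟨Λ, h⟩
  obtain ⟨k, hk, ε₁, hε₁, H₁⟩ := h.exists_frobNorm_sub_le hAC hC1
  obtain ⟨ε₂, hε₂, H₂⟩ := hAC.exists_perturbed_wellPosed hC1 (Fin d)
  have hx0 : frobNorm X ≠ 0 := fun h0 => hX0 (frobNorm_eq_zero.1 h0)
  have hx : 0 < frobNorm X := (frobNorm_nonneg X).lt_of_ne' hx0
  refine ⟨k / frobNorm X, by positivity, min ε₁ ε₂, by positivity, ?_⟩
  intro ε ΔA ΔB ΔC ΔD h0 hε hA hB hC' hD
  simp only [isComplexRBLSESolution_iff, complexCol_add]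
  simp only [← frobNorm_complexCol] at hA hB hC' hD
  obtain ⟨hAC', hrank, hsurj⟩ := H₂ ε (complexCol ΔA) (complexCol ΔC) h0
    (hε.trans (min_le_right _ _)) hA hC'
  obtain ⟨X', Λ', h'⟩ := exists_isKKT hsurj (complexCol B + complexCol ΔB)
    (complexCol D + complexCol ΔD)
  refine ⟨hrank.trans hcard, ⟨X', h'.isLSESolution, fun Y hY => h'.eq_of_isLSESolution hAC' hY⟩,
    fun Y hY => ?_⟩
  obtain rfl := h'.eq_of_isLSESolution hAC' hY
  have hfin := H₁ ε _ _ _ _ _ _ h0 (hε.trans (min_le_left _ _)) hA hB hC' hD h'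
  rw [div_le_iff₀ hx]
  refine hfin.trans_eq ?_
  -- Division by zero gives `0` in the stated bound. If `‖A‖_F` or `‖C‖_F` vanishes, the matching
  -- pseudoinverse factor vanishes too, so the normalized bound still equals the unnormalized one.
  have hA0 : frobNorm (complexCol A) = 0 →
      twoNorm (pinv (complexCol A * projC C)) = 0 := fun h0 => by
    rw [frobNorm_eq_zero.1 h0, Matrix.zero_mul, pinv_zero, twoNorm_zero]
  have hC0 : frobNorm (complexCol C) = 0 → twoNorm (lmatC A C) = 0 := fun h0 => by
    rw [lmatC, frobNorm_eq_zero.1 h0, pinv_zero, Matrix.mul_zero, twoNorm_zero]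
  change ε * (twoNorm (lmatC A C) * _ + twoNorm (pinv (complexCol A * projC C)) * _
    + twoNorm (pinv (complexCol A * projC C)) ^ 2 *
      (frobNorm (complexCol C) * twoNorm (complexCol A * lmatC A C) + _) *
      frobNorm (residC A B X)) + _ = _
  unfold condA condB
  generalize frobNorm (complexCol A) = a at *
  generalize frobNorm (complexCol C) = c at *
  generalize twoNorm (pinv (complexCol A * projC C)) = g at *
  generalize twoNorm (lmatC A C) = l at *
  generalize frobNorm X = x at *
  by_cases ha : a = 0
  · rw [hA0 ha]
    by_cases hc : c = 0
    · rw [hC0 hc]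
      field_simp
      simp
    · field_simp
      simp
  · by_cases hc : c = 0
    · rw [hC0 hc]
      field_simp
      simp
    · field_simp
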